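/- Let $d\ge 3$ and $s\ge 1$ be integers with $s\le\sqrt d$, and let $\sigma>0$. One observes $y_j=\theta_j+\sigma\xi_j$, $j=1,\dots,d$, where $\theta\in\mathbb R^d$ is unknown and the $\xi_j$ are i.i.d. standard normal; $\mathbf E_\theta$ denotes the corresponding expectation. Let $L(\theta)=\sum_{j=1}^d\theta_j$ and let $B_0(s)$ be the set of all $\theta\in\mathbb R^d$ with at most $s$ non-zero components. Let $y_{(1)}^2\le\dots\le y_{(d)}^2$ be the order statistics of $y_1^2,\dots,y_d^2$, and set $$\hat\sigma=3\Big(\frac1d\sum_{1\le j\le d-\sqrt d}y_{(j)}^2\Big)^{1/2},\qquad \tilde L=\sum_{j=1}^d y_j\,\mathbf 1\Big\{|y_j|>\hat\sigma\sqrt{2\log(1+d/s^2)}\Big\}.$$ Then there exists an absolute constant $C>0$ (not depending on $d$, $s$, $\sigma$) such that, for all such $d$, $s$ and $\sigma$, $$\sup_{\theta\in B_0(s)}\mathbf E_\theta\big(\tilde L-L(\theta)\big)^2\le C\,\sigma^2s^2\log(1+d/s^2).$$ -/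

import Mathlib

open MeasureTheory ProbabilityTheory
open scoped ENNReal

noncomputable section

namespace SparseMean

/-- The law `P_θ` of the observations `y_j = θ_j + σ ξ_j`, `j = 1, …, d`, where the `ξ_j` are
i.i.d. standard normal random variables. -/
def obsLaw {d : ℕ} (σ : ℝ) (θ : Fin d → ℝ) : Measure (Fin d → ℝ) :=
  (Measure.pi fun _ : Fin d => gaussianReal 0 1).map fun ξ j => θ j + σ * ξ j

/-- The class `B_0(s)` of vectors with at most `s` nonzero components. -/
def B0 (d s : ℕ) : Set (Fin d → ℝ) := {θ | hammingNorm θ ≤ s}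

/-- The linear functional `L(θ) = ∑ θ_j`. -/
def linFunctional {d : ℕ} (θ : Fin d → ℝ) : ℝ := ∑ j, θ j

/-- The order statistics of `y_1^2, …, y_d^2` in nondecreasing order. The index is 0-based: the
value at `j` is the `(j + 1)`-st smallest of the squares. -/
def sqOrderStat {d : ℕ} (y : Fin d → ℝ) (j : Fin d) : ℝ :=
  y (Tuple.sort (fun i => y i ^ 2) j) ^ 2

/-- The noise level over-estimator: `3` times the square root of `1 / d` times the sum of the
order statistics of the squares whose (1-based) rank is at most `d - √d`. -/
def sigmaHat {d : ℕ} (y : Fin d → ℝ) : ℝ :=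
  3 * √((1 / (d : ℝ)) *
    ∑ j : Fin d, if ((j : ℕ) : ℝ) + 1 ≤ (d : ℝ) - √(d : ℝ) then sqOrderStat y j else 0)

/-- The thresholding estimator of `L(θ)` with `σ` replaced by its over-estimator. -/
def linEstimator {d : ℕ} (s : ℕ) (y : Fin d → ℝ) : ℝ :=
  ∑ j, if sigmaHat y * √(2 * Real.log (1 + (d : ℝ) / (s : ℝ) ^ 2)) < |y j| then y j else 0

/-- The mean squared error `E_θ (T(y) - L(θ))^2`, as an element of `[0, ∞]`. -/
def sqRisk {d : ℕ} (σ : ℝ) (T : (Fin d → ℝ) → ℝ) (θ : Fin d → ℝ) : ℝ≥0∞ :=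
  ∫⁻ y, ENNReal.ofReal ((T y - linFunctional θ) ^ 2) ∂(obsLaw σ θ)

/-- The rate `σ^2 s^2 log (1 + d / s^2)`. -/
def linRate (σ : ℝ) (s d : ℕ) : ℝ :=
  σ ^ 2 * (s : ℝ) ^ 2 * Real.log (1 + (d : ℝ) / (s : ℝ) ^ 2)

end SparseMean

end

open Filter
open scoped Finset Topology

/-!
The estimator is the sum over the coordinates of hard thresholding at level `t σ̂`, where
`t ^ 2 = 2 log (1 + d / s ^ 2)`.

On the support of `θ`, each coordinate contributes an error of at most `|σ ξ_j| + t σ̂`, and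
`E σ̂ ^ 2 ≤ 9 σ ^ 2` because the trimmed sum defining `σ̂` is smaller than the sum over the zero
coordinates of `θ`. The at most `s` coordinates of the support thus contribute at most a multiple
of `σ ^ 2 s ^ 2 t ^ 2`.

Off the support, `σ̂` is unchanged by flipping the sign of a coordinate, so that the thresholded
coordinates are orthogonal and only their second moments matter. If `σ ≤ σ̂`, a coordinate survives
only if `t < |ξ_j|`, which costs a Gaussian tail of order `t exp (-t ^ 2 / 2)`. If `σ̂ < σ`, then at
most about `d / 4` of the zero coordinates satisfy `2 / 3 ≤ |ξ_i|`, while about `d / 2` of them are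
expected to do so: by independence this has probability exponentially small in `d`.
-/

namespace SparseMean

section TrimmedSum

variable {ι : Type*}

lemma sum_initial_le_sum_of_monotone {M : Type*} [AddCommMonoid M] [Preorder M]
    [AddLeftMono M] {n : ℕ} {g : Fin n → M} (hg : Monotone g) (T : Finset (Fin n)) :
    ∑ j : Fin n with j.val < #T, g j ≤ ∑ j ∈ T, g j := by
  have hn : #T ≤ n := by simpa using T.card_le_univ
  let e := T.orderEmbOfFin rfl
  have le_e (l : Fin #T) : Fin.castLE hn l ≤ e l := Fin.le_def.2 <| by
    simpa using Finset.card_le_card_of_injOn (s := Finset.Iio l) (t := Finset.Iio (e l)) e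
      (fun i hi => by simpa using hi) e.injective.injOn
  have initial_eq : ({j | j.val < #T} : Finset (Fin n)) =
      Finset.univ.map (Fin.castLEEmb hn) := by
    ext j
    simp only [Finset.mem_filter_univ, Finset.mem_map, Finset.mem_univ, true_and]
    exact ⟨fun hj => ⟨⟨j, hj⟩, rfl⟩, fun ⟨l, hl⟩ => hl ▸ l.isLt⟩
  calc ∑ j : Fin n with j.val < #T, g j = ∑ l, g (Fin.castLE hn l) := by
        rw [initial_eq, Finset.sum_map]; rfl
    _ ≤ ∑ l, g (e l) := Finset.sum_le_sum fun l _ => hg (le_e l)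
    _ = ∑ j ∈ T, g j := by
        conv_rhs => rw [← T.map_orderEmbOfFin_univ rfl, Finset.sum_map]
        rfl

/-- The sum of the `k` smallest values of `f`, as a minimum over the `k`-element sets of indices
(`0` if there is no such set). -/
noncomputable def trimmedSum (k : ℕ) (f : ι → ℝ) : ℝ :=
  ⨅ T : {T : Finset ι // #T = k}, ∑ i ∈ T.1, f i

lemma sum_sort_eq_trimmedSum {n k : ℕ} (hk : k ≤ n) (f : Fin n → ℝ) :
    ∑ j : Fin n with j.val < k, f (Tuple.sort f j) = trimmedSum k f := by
  let A : Finset (Fin n) := ({j | j.val < k} : Finset (Fin n)).map (Tuple.sort f).toEmbedding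
  have hA : #A = k := by simp [A, Fin.card_filter_val_lt, hk]
  have : Nonempty {T : Finset (Fin n) // #T = k} := ⟨A, hA⟩
  apply le_antisymm
  · refine le_ciInf fun ⟨T, hT⟩ => ?_
    have h := sum_initial_le_sum_of_monotone (Tuple.monotone_sort f)
      (T.map (Tuple.sort f).symm.toEmbedding)
    simpa [hT] using h
  · calc trimmedSum k f ≤ ∑ i ∈ A, f i :=
          ciInf_le (Finite.bddBelow_range _) (⟨A, hA⟩ : {T : Finset (Fin n) // #T = k})
      _ = ∑ j : Fin n with j.val < k, f (Tuple.sort f j) := Finset.sum_map ..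

lemma trimmedSum_nonneg {f : ι → ℝ} (hf : 0 ≤ f) (k : ℕ) : 0 ≤ trimmedSum k f :=
  Real.iInf_nonneg fun _ => Finset.sum_nonneg fun i _ => hf i

lemma trimmedSum_le_sum [Finite ι] {f : ι → ℝ} (hf : 0 ≤ f) {k : ℕ} {T : Finset ι} (hk : k ≤ #T) :
    trimmedSum k f ≤ ∑ i ∈ T, f i := by
  obtain ⟨S, hST, hS⟩ := Finset.exists_subset_card_eq hk
  calc trimmedSum k f ≤ ∑ i ∈ S, f i :=
        ciInf_le (Finite.bddBelow_range _) (⟨S, hS⟩ : {T : Finset ι // #T = k})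
    _ ≤ ∑ i ∈ T, f i := Finset.sum_le_sum_of_subset_of_nonneg hST fun i _ _ => hf i

lemma mul_card_le_trimmedSum [Fintype ι] {f : ι → ℝ} (hf : 0 ≤ f) {k : ℕ}
    (hk : k ≤ Fintype.card ι) {a : ℝ} (ha : 0 ≤ a) {N : Finset ι} (hN : ∀ i ∈ N, a ≤ f i) :
    a * ((#N : ℝ) + k - Fintype.card ι) ≤ trimmedSum k f := by
  classical
  obtain ⟨S, -, hS⟩ := Finset.exists_subset_card_eq (s := (Finset.univ : Finset ι)) hk
  have : Nonempty {T : Finset ι // #T = k} := ⟨S, hS⟩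
  refine le_ciInf fun ⟨T, hT⟩ => ?_
  have hcard : (#N : ℝ) + k - Fintype.card ι ≤ #(N ∩ T) := by
    have h := Finset.card_union_add_card_inter N T
    have h' := (N ∪ T).card_le_univ
    rw [sub_le_iff_le_add]
    exact_mod_cast (by lia : #N + k ≤ #(N ∩ T) + Fintype.card ι)
  calc a * ((#N : ℝ) + k - Fintype.card ι) ≤ #(N ∩ T) • a := by
        rw [nsmul_eq_mul, mul_comm]; gcongr
    _ ≤ ∑ i ∈ N ∩ T, f i :=
        Finset.card_nsmul_le_sum _ _ _ fun i hi => hN i (Finset.mem_of_mem_inter_left hi)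
    _ ≤ ∑ i ∈ T, f i :=
        Finset.sum_le_sum_of_subset_of_nonneg Finset.inter_subset_right fun i _ _ => hf i

lemma measurable_trimmedSum [Finite ι] (k : ℕ) : Measurable (trimmedSum k : (ι → ℝ) → ℝ) :=
  .iInf fun T => Finset.measurable_fun_sum T.1 fun i _ => measurable_pi_apply i

end TrimmedSum

section SigmaHat

variable {d : ℕ}

/-- The number `⌊d - √d⌋` of order statistics which enter `sigmaHat`. -/
noncomputable def trimmedCount (d : ℕ) : ℕ := ⌊(d : ℝ) - √(d : ℝ)⌋₊

lemma trimmedCount_le (d : ℕ) : trimmedCount d ≤ d :=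
  Nat.floor_le_of_le (by linarith [Real.sqrt_nonneg (d : ℝ)])

lemma sub_lt_trimmedCount (d : ℕ) : (d : ℝ) - √(d : ℝ) - 1 < trimmedCount d :=
  Nat.sub_one_lt_floor _

lemma sigmaHat_eq (y : Fin d → ℝ) :
    sigmaHat y = 3 * √(1 / d * trimmedSum (trimmedCount d) fun i => y i ^ 2) := by
  rw [← sum_sort_eq_trimmedSum (trimmedCount_le d), Finset.sum_filter]
  have rank_le_iff (j : Fin d) :
      ((j : ℕ) : ℝ) + 1 ≤ (d : ℝ) - √(d : ℝ) ↔ (j : ℕ) < trimmedCount d := by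
    rw [trimmedCount, ← Nat.succ_le_iff, Nat.le_floor_iff' (Nat.succ_ne_zero _), Nat.cast_succ]
  simp only [sigmaHat, sqOrderStat, rank_le_iff]

lemma sigmaHat_nonneg (y : Fin d → ℝ) : 0 ≤ sigmaHat y := by
  unfold sigmaHat
  positivity

lemma sigmaHat_sq (y : Fin d → ℝ) :
    sigmaHat y ^ 2 = 9 / d * trimmedSum (trimmedCount d) fun i => y i ^ 2 := by
  have := trimmedSum_nonneg (fun i => sq_nonneg (y i)) (trimmedCount d)
  rw [sigmaHat_eq, mul_pow, Real.sq_sqrt (by positivity)]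
  ring

@[fun_prop]
lemma measurable_sigmaHat : Measurable (sigmaHat : (Fin d → ℝ) → ℝ) := by
  have : Measurable fun y : Fin d → ℝ => trimmedSum (trimmedCount d) fun i => y i ^ 2 :=
    (measurable_trimmedSum _).comp (by fun_prop)
  rw [funext sigmaHat_eq]
  fun_prop

lemma sigmaHat_update_neg (y : Fin d → ℝ) (j : Fin d) :
    sigmaHat (Function.update y j (-y j)) = sigmaHat y := by
  have sq_eq : (fun i => Function.update y j (-y j) i ^ 2) = fun i => y i ^ 2 := by
    funext i
    obtain rfl | hij := eq_or_ne i j <;> simp [*]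
  rw [sigmaHat_eq, sigmaHat_eq, sq_eq]

lemma sigmaHat_sq_le {T : Finset (Fin d)} (hT : (d : ℝ) - √(d : ℝ) ≤ #T) (y : Fin d → ℝ) :
    sigmaHat y ^ 2 ≤ 9 / d * ∑ i ∈ T, y i ^ 2 := by
  rw [sigmaHat_sq]
  gcongr
  exact trimmedSum_le_sum (fun i => sq_nonneg (y i)) (Nat.floor_le_of_le hT)

lemma card_le_of_sigmaHat_lt {σ : ℝ} {y : Fin d → ℝ}
    (h : sigmaHat y < σ) {N : Finset (Fin d)} (hN : ∀ i ∈ N, 2 / 3 * σ ≤ |y i|) :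
    (#N : ℝ) ≤ d / 4 + √(d : ℝ) + 1 := by
  obtain rfl | hd := d.eq_zero_or_pos
  · simp [Finset.eq_empty_of_isEmpty N]
  have hσ : 0 < σ := (sigmaHat_nonneg y).trans_lt h
  have sigmaHat_sq_lt : sigmaHat y ^ 2 < σ ^ 2 := by
    have := sigmaHat_nonneg y
    gcongr
  have le_trimmedSum := mul_card_le_trimmedSum (fun i => sq_nonneg (y i))
    ((trimmedCount_le d).trans_eq (Fintype.card_fin d).symm) (by positivity)
    (fun i hi => (pow_le_pow_left₀ (by positivity) (hN i hi) 2).trans_eq (sq_abs _))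
  have key : σ ^ 2 * (4 * ((#N : ℝ) - √(d : ℝ) - 1)) < σ ^ 2 * d := by
    rw [sigmaHat_sq, div_mul_eq_mul_div, div_lt_iff₀ (by positivity)] at sigmaHat_sq_lt
    rw [Fintype.card_fin] at le_trimmedSum
    nlinarith [mul_lt_mul_of_pos_left (sub_lt_trimmedCount d) (sq_pos_of_pos hσ)]
  linarith [lt_of_mul_lt_mul_left key (sq_nonneg σ)]

end SigmaHat

section Gaussian

lemma gaussianPDFReal_zero_one (u : ℝ) :
    gaussianPDFReal 0 1 u = (√(2 * Real.pi))⁻¹ * Real.exp (-(1 / 2) * u ^ 2) := by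
  simp only [gaussianPDFReal, NNReal.coe_one, mul_one, sub_zero]
  ring_nf

lemma gaussianPDFReal_le_exp (u : ℝ) :
    gaussianPDFReal 0 1 u ≤ 2 / 5 * Real.exp (-(1 / 2) * u ^ 2) := by
  have : (√(2 * Real.pi))⁻¹ ≤ 2 / 5 := by
    rw [inv_le_comm₀ (by positivity) (by norm_num)]
    exact Real.le_sqrt_of_sq_le (by norm_num; linarith [Real.pi_gt_d2])
  rw [gaussianPDFReal_zero_one]
  gcongr

lemma gaussianPDFReal_zero_one_neg (u : ℝ) : gaussianPDFReal 0 1 (-u) = gaussianPDFReal 0 1 u := by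
  simp only [gaussianPDFReal_zero_one, neg_sq]

lemma hasDerivAt_gaussianPDFReal (u : ℝ) :
    HasDerivAt (gaussianPDFReal 0 1) (-u * gaussianPDFReal 0 1 u) u := by
  rw [funext gaussianPDFReal_zero_one]
  refine (((hasDerivAt_pow 2 u).const_mul (-(1 / 2))).exp.const_mul
    (√(2 * Real.pi))⁻¹).congr_deriv ?_
  push_cast
  ring

lemma hasDerivAt_neg_mul_gaussianPDFReal (u : ℝ) :
    HasDerivAt (fun u => -(u * gaussianPDFReal 0 1 u)) ((u ^ 2 - 1) * gaussianPDFReal 0 1 u) u := by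
  refine ((hasDerivAt_id' u).fun_mul (hasDerivAt_gaussianPDFReal u)).fun_neg.congr_deriv ?_
  ring

lemma tendsto_neg_mul_gaussianPDFReal :
    Tendsto (fun u => -(u * gaussianPDFReal 0 1 u)) atTop (𝓝 0) := by
  have exp_tendsto : Tendsto (fun u : ℝ => Real.exp (-(1 / 2) * u)) atTop (𝓝 0) :=
    Real.tendsto_exp_atBot.comp (tendsto_id.const_mul_atTop_of_neg (by norm_num))
  have h := (rpow_mul_exp_neg_mul_sq_isLittleO_exp_neg (b := 1 / 2) (by norm_num) 1).trans_tendsto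
    exp_tendsto
  convert (h.const_mul (√(2 * Real.pi))⁻¹).neg using 2 with u
  · rw [gaussianPDFReal_zero_one, Real.rpow_one]
    ring
  · simp

lemma sq_sub_one_mul_gaussianPDFReal_nonneg {u : ℝ} (hu : 1 ≤ u) :
    0 ≤ (u ^ 2 - 1) * gaussianPDFReal 0 1 u :=
  mul_nonneg (sub_nonneg.2 (one_le_pow₀ hu)) (gaussianPDFReal_nonneg 0 1 u)

lemma integrableOn_Ioi_sq_sub_one_mul_gaussianPDFReal {t : ℝ} (ht : 1 ≤ t) :
    IntegrableOn (fun u => (u ^ 2 - 1) * gaussianPDFReal 0 1 u) (Set.Ioi t) :=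
  integrableOn_Ioi_deriv_of_nonneg' (fun u _ => hasDerivAt_neg_mul_gaussianPDFReal u)
    (fun _ hu => sq_sub_one_mul_gaussianPDFReal_nonneg (ht.trans (le_of_lt hu)))
    tendsto_neg_mul_gaussianPDFReal

lemma integral_Ioi_sq_sub_one_mul_gaussianPDFReal {t : ℝ} (ht : 1 ≤ t) :
    ∫ u in Set.Ioi t, (u ^ 2 - 1) * gaussianPDFReal 0 1 u = t * gaussianPDFReal 0 1 t := by
  rw [integral_Ioi_of_hasDerivAt_of_nonneg' (fun u _ => hasDerivAt_neg_mul_gaussianPDFReal u)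
    (fun _ hu => sq_sub_one_mul_gaussianPDFReal_nonneg (ht.trans (le_of_lt hu)))
    tendsto_neg_mul_gaussianPDFReal]
  ring

lemma integrable_sq_gaussianReal : Integrable (fun u => u ^ 2) (gaussianReal 0 1) :=
  (memLp_id_gaussianReal 2).integrable_sq

lemma integral_sq_gaussianReal : ∫ u, u ^ 2 ∂gaussianReal 0 1 = 1 := by
  have h := variance_eq_integral (μ := gaussianReal 0 1) (X := fun u => u) (by fun_prop)
  rw [variance_fun_id_gaussianReal, integral_id_gaussianReal] at h
  simpa using h.symm

lemma setIntegral_sq_gaussianReal_eq {t : ℝ} (ht : 0 ≤ t) :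
    ∫ u in {u | t < |u|}, u ^ 2 ∂gaussianReal 0 1 =
      2 * ∫ u in Set.Ioi t, u ^ 2 * gaussianPDFReal 0 1 u := by
  have indicator_eq (u : ℝ) :
      gaussianPDFReal 0 1 u • {u : ℝ | t < |u|}.indicator (fun u => u ^ 2) u =
        (Set.Ioi t).indicator (fun v => v ^ 2 * gaussianPDFReal 0 1 v) |u| := by
    have even : gaussianPDFReal 0 1 |u| = gaussianPDFReal 0 1 u := by
      rcases abs_choice u with h | h <;> simp only [h, gaussianPDFReal_zero_one_neg]
    by_cases hu : t < |u| <;> simp [hu, even, mul_comm]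
  rw [← integral_indicator (measurableSet_lt measurable_const (by fun_prop)),
    integral_gaussianReal_eq_integral_smul one_ne_zero]
  simp only [indicator_eq]
  rw [integral_comp_abs, setIntegral_indicator measurableSet_Ioi,
    Set.inter_eq_right.2 (Set.Ioi_subset_Ioi ht)]

lemma setIntegral_sq_gaussianReal_le {t : ℝ} (ht0 : 0 < t) (ht : 4 / 3 ≤ t ^ 2) :
    ∫ u in {u | t < |u|}, u ^ 2 ∂gaussianReal 0 1 ≤ 4 * t * Real.exp (-(t ^ 2 / 2)) := by
  have one_le : 1 ≤ t := by nlinarith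
  have tail_le : ∫ u in Set.Ioi t, u ^ 2 * gaussianPDFReal 0 1 u ≤
      4 * (t * gaussianPDFReal 0 1 t) := by
    rw [← integral_Ioi_sq_sub_one_mul_gaussianPDFReal one_le, ← integral_const_mul]
    refine integral_mono_of_nonneg (.of_forall fun u => mul_nonneg (sq_nonneg u)
      (gaussianPDFReal_nonneg 0 1 u))
      ((integrableOn_Ioi_sq_sub_one_mul_gaussianPDFReal one_le).const_mul 4) ?_
    filter_upwards [ae_restrict_mem measurableSet_Ioi] with u hu
    nlinarith [gaussianPDFReal_nonneg 0 1 u, pow_lt_pow_left₀ hu ht0.le two_ne_zero]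
  calc ∫ u in {u | t < |u|}, u ^ 2 ∂gaussianReal 0 1
      ≤ 2 * (4 * (t * gaussianPDFReal 0 1 t)) := by
        rw [setIntegral_sq_gaussianReal_eq ht0.le]
        gcongr
    _ ≤ 2 * (4 * (t * (2 / 5 * Real.exp (-(1 / 2) * t ^ 2)))) := by
        gcongr
        exact gaussianPDFReal_le_exp t
    _ ≤ 4 * t * Real.exp (-(t ^ 2 / 2)) := by
        rw [show -(1 / 2) * t ^ 2 = -(t ^ 2 / 2) by ring]
        nlinarith [mul_pos ht0 (Real.exp_pos (-(t ^ 2 / 2)))]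

lemma gaussianReal_real_Ioo_le {a b : ℝ} (hab : a ≤ b) :
    (gaussianReal 0 1).real (Set.Ioo a b) ≤ 2 / 5 * (b - a) := by
  have pdf_le (u : ℝ) : gaussianPDFReal 0 1 u ≤ 2 / 5 :=
    (gaussianPDFReal_le_exp u).trans
      (mul_le_of_le_one_right (by norm_num) (Real.exp_le_one_iff.2 (by nlinarith [sq_nonneg u])))
  calc (gaussianReal 0 1).real (Set.Ioo a b) = ∫ u in Set.Ioo a b, gaussianPDFReal 0 1 u := by
        rw [measureReal_def, gaussianReal_apply_eq_integral 0 one_ne_zero, ENNReal.toReal_ofReal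
          (integral_nonneg fun _ => gaussianPDFReal_nonneg 0 1 _)]
    _ ≤ ∫ _ in Set.Ioo a b, 2 / 5 :=
        setIntegral_mono (integrable_gaussianPDFReal 0 1).integrableOn
          (integrableOn_const (by simp)) pdf_le
    _ = 2 / 5 * (b - a) := by
        rw [setIntegral_const, Real.volume_real_Ioo_of_le hab, smul_eq_mul, mul_comm]

/-- The weight `2 ^ (-1{2 / 3 ≤ |u|})`. A product of such weights counts the large coordinates
exponentially, so that independence bounds the event of having few of them by a product of
means. -/
noncomputable def largeWeight (u : ℝ) : ℝ := if 2 / 3 ≤ |u| then 1 / 2 else 1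

lemma largeWeight_nonneg (u : ℝ) : 0 ≤ largeWeight u := by
  unfold largeWeight
  split_ifs <;> norm_num

lemma largeWeight_le_one (u : ℝ) : largeWeight u ≤ 1 := by
  unfold largeWeight
  split_ifs <;> norm_num

lemma measurable_largeWeight : Measurable largeWeight :=
  .ite (measurableSet_le measurable_const measurable_id.abs) measurable_const measurable_const

lemma integrable_largeWeight : Integrable largeWeight (gaussianReal 0 1) :=
  .of_bound measurable_largeWeight.aestronglyMeasurable 1 <| .of_forall fun u => by
    simpa [abs_of_nonneg (largeWeight_nonneg u)] using largeWeight_le_one u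

lemma prod_largeWeight {ι : Type*} (T : Finset ι) (ξ : ι → ℝ) :
    ∏ i ∈ T, largeWeight (ξ i) = (1 / 2) ^ #{i ∈ T | 2 / 3 ≤ |ξ i|} := by
  simp only [largeWeight, Finset.prod_ite, Finset.prod_const, one_pow, mul_one]

lemma integral_largeWeight_le : ∫ u, largeWeight u ∂gaussianReal 0 1 ≤ 2 ^ (-(3 / 8) : ℝ) := by
  have weight_eq (u : ℝ) :
      largeWeight u = 1 / 2 + (Set.Ioo (-(2 / 3)) (2 / 3)).indicator (fun _ => 1 / 2) u := by
    by_cases h : 2 / 3 ≤ |u|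
    · simp [largeWeight, ← abs_lt, h]
    · simp [largeWeight, ← abs_lt, h, not_le.1 h]
      norm_num
  calc ∫ u, largeWeight u ∂gaussianReal 0 1
      = 1 / 2 + (gaussianReal 0 1).real (Set.Ioo (-(2 / 3)) (2 / 3)) * (1 / 2) := by
        simp only [weight_eq]
        rw [integral_add (integrable_const _) ((integrable_const _).indicator measurableSet_Ioo),
          integral_indicator_const _ measurableSet_Ioo, integral_const, probReal_univ, one_smul,
          smul_eq_mul]
    _ ≤ 1 / 2 + 2 / 5 * (2 / 3 - -(2 / 3)) * (1 / 2) := by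
        gcongr
        exact gaussianReal_real_Ioo_le (by norm_num)
    _ ≤ 2 ^ (-(3 / 8) : ℝ) := by
        rw [← pow_le_pow_iff_left₀ (by norm_num) (by positivity) (by norm_num : 8 ≠ 0),
          ← Real.rpow_mul_natCast zero_le_two]
        norm_num

end Gaussian

section Pi

variable {ι : Type*} [Fintype ι]

lemma integral_pi_eq_zero_of_odd [DecidableEq ι] {ν : Measure ℝ} [SigmaFinite ν]
    (hν : ν.map Neg.neg = ν) (j : ι) {G : (ι → ℝ) → ℝ}
    (hodd : ∀ ξ, G (Function.update ξ j (-ξ j)) = -G ξ) :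
    ∫ ξ, G ξ ∂Measure.pi (fun _ : ι => ν) = 0 := by
  let flip : (ι → ℝ) ≃ᵐ (ι → ℝ) :=
    .ofInvolutive (fun ξ => Function.update ξ j (-ξ j)) (fun ξ => by simp) (by fun_prop)
  have flip_eq (ξ : ι → ℝ) : flip ξ = fun i => (if i = j then Neg.neg else id) (ξ i) := by
    change Function.update ξ j (-ξ j) = _
    funext i
    obtain rfl | hij := eq_or_ne i j <;> simp [*]
  have flip_preserving :
      MeasurePreserving flip (Measure.pi fun _ => ν) (Measure.pi fun _ => ν) := by
    rw [funext flip_eq]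
    refine measurePreserving_pi _ _ fun i => ?_
    split_ifs
    · exact ⟨measurable_neg, hν⟩
    · exact .id _
  have h := flip_preserving.integral_comp' G
  change ∫ ξ, G (Function.update ξ j (-ξ j)) ∂_ = _ at h
  simp only [hodd, integral_neg] at h
  linarith

variable {α : Type*} [MeasurableSpace α] {ν : Measure α} [IsProbabilityMeasure ν]

lemma integrable_and_integral_finsetProd_pi (T : Finset ι) {f : ι → α → ℝ}
    (hf : ∀ i ∈ T, Integrable (f i) ν) :
    Integrable (fun ξ => ∏ i ∈ T, f i (ξ i)) (Measure.pi fun _ : ι => ν) ∧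
      ∫ ξ, ∏ i ∈ T, f i (ξ i) ∂Measure.pi (fun _ : ι => ν) = ∏ i ∈ T, ∫ u, f i u ∂ν := by
  classical
  let F (i : ι) : α → ℝ := if i ∈ T then f i else fun _ => 1
  have prod_eq (ξ : ι → α) : ∏ i ∈ T, f i (ξ i) = ∏ i, F i (ξ i) := by
    rw [← Finset.prod_subset T.subset_univ fun i _ hi => by simp [F, hi]]
    exact Finset.prod_congr rfl fun i hi => by simp [F, hi]
  have integrable_F (i : ι) : Integrable (F i) ν := by
    by_cases hi : i ∈ T
    · simpa [F, hi] using hf i hi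
    · simp [F, hi]
  simp only [prod_eq]
  refine ⟨.fintype_prod integrable_F, ?_⟩
  rw [integral_fintype_prod_eq_prod,
    ← Finset.prod_subset T.subset_univ fun i _ hi => by simp [F, hi]]
  exact Finset.prod_congr rfl fun i hi => by simp [F, hi]

lemma integrable_and_integral_mul_prod_pi {f w : α → ℝ} (hf : Integrable f ν) (hw : Integrable w ν)
    {T : Finset ι} {j : ι} (hj : j ∉ T) :
    Integrable (fun ξ => f (ξ j) * ∏ i ∈ T, w (ξ i)) (Measure.pi fun _ : ι => ν) ∧
      ∫ ξ, f (ξ j) * ∏ i ∈ T, w (ξ i) ∂Measure.pi (fun _ : ι => ν) =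
        (∫ u, f u ∂ν) * (∫ u, w u ∂ν) ^ #T := by
  classical
  let g : ι → α → ℝ := Function.update (fun _ => w) j f
  have g_self : g j = f := Function.update_self ..
  have g_of_mem {i : ι} (hi : i ∈ T) : g i = w :=
    Function.update_of_ne (ne_of_mem_of_not_mem hi hj) ..
  have g_int : ∀ i ∈ insert j T, Integrable (g i) ν :=
    Finset.forall_mem_insert .. |>.2 ⟨g_self ▸ hf, fun i hi => g_of_mem hi ▸ hw⟩
  have prod_eq (ξ : ι → α) : ∏ i ∈ insert j T, g i (ξ i) = f (ξ j) * ∏ i ∈ T, w (ξ i) := by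
    rw [Finset.prod_insert hj, g_self, Finset.prod_congr rfl fun i hi => by rw [g_of_mem hi]]
  have h := integrable_and_integral_finsetProd_pi (insert j T) g_int
  simp only [prod_eq] at h
  rwa [Finset.prod_insert hj, g_self, Finset.prod_eq_pow_card fun i hi => by rw [g_of_mem hi]] at h

end Pi

section SecondMoment

variable {Ω ι : Type*} [MeasurableSpace Ω] {μ : Measure Ω} {f : ι → Ω → ℝ}

lemma integral_sq_sum_eq_of_orthogonal {S : Finset ι} (hf : ∀ i ∈ S, MemLp (f i) 2 μ)
    (horth : ∀ i ∈ S, ∀ j ∈ S, i ≠ j → ∫ ω, f i ω * f j ω ∂μ = 0) :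
    ∫ ω, (∑ i ∈ S, f i ω) ^ 2 ∂μ = ∑ i ∈ S, ∫ ω, f i ω ^ 2 ∂μ := by
  have integrable_mul : ∀ i ∈ S, ∀ j ∈ S, Integrable (fun ω => f i ω * f j ω) μ :=
    fun i hi j hj => (hf i hi).integrable_mul (hf j hj)
  simp only [sq, Finset.sum_mul_sum]
  rw [integral_finsetSum _ fun i hi => integrable_finsetSum _ (integrable_mul i hi)]
  refine Finset.sum_congr rfl fun i hi => ?_
  rw [integral_finsetSum _ (integrable_mul i hi)]
  exact Finset.sum_eq_single_of_mem i hi fun j hj hji => horth i hi j hj hji.symm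

lemma integral_sq_sum_le_card_sq_mul {S : Finset ι} (hf : ∀ i ∈ S, MemLp (f i) 2 μ) {c : ℝ}
    (hc : ∀ i ∈ S, ∫ ω, f i ω ^ 2 ∂μ ≤ c) :
    ∫ ω, (∑ i ∈ S, f i ω) ^ 2 ∂μ ≤ (#S : ℝ) ^ 2 * c := by
  have integrable_sq : ∀ i ∈ S, Integrable (fun ω => f i ω ^ 2) μ :=
    fun i hi => (hf i hi).integrable_sq
  calc ∫ ω, (∑ i ∈ S, f i ω) ^ 2 ∂μ ≤ ∫ ω, #S * ∑ i ∈ S, f i ω ^ 2 ∂μ :=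
        integral_mono (memLp_finsetSum S hf).integrable_sq
          ((integrable_finsetSum S integrable_sq).const_mul _) fun ω => sq_sum_le_card_mul_sum_sq
    _ = #S * ∑ i ∈ S, ∫ ω, f i ω ^ 2 ∂μ := by
        rw [integral_const_mul, integral_finsetSum S integrable_sq]
    _ ≤ #S * (#S • c) := by gcongr; exact Finset.sum_le_card_nsmul S _ c hc
    _ = (#S : ℝ) ^ 2 * c := by rw [nsmul_eq_mul]; ring

lemma integral_add_sq_le {f g : Ω → ℝ} (hf : MemLp f 2 μ) (hg : MemLp g 2 μ) :
    ∫ ω, (f ω + g ω) ^ 2 ∂μ ≤ 2 * ∫ ω, f ω ^ 2 ∂μ + 2 * ∫ ω, g ω ^ 2 ∂μ := by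
  have hf2 := hf.integrable_sq.const_mul 2
  have hg2 := hg.integrable_sq.const_mul 2
  rw [← integral_const_mul, ← integral_const_mul, ← integral_add hf2 hg2]
  refine integral_mono (hf.add hg).integrable_sq (hf2.add hg2) fun ω => ?_
  exact add_sq_le.trans_eq (mul_add _ _ _)

end SecondMoment

section Observation

variable {d : ℕ} {σ : ℝ} {θ : Fin d → ℝ}

/-- The law of the noise vector `(ξ_1, …, ξ_d)`. -/
noncomputable abbrev noiseLaw (d : ℕ) : Measure (Fin d → ℝ) := Measure.pi fun _ => gaussianReal 0 1

/-- The observation `y = θ + σ ξ` as a function of the noise `ξ`. -/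
noncomputable def observation (σ : ℝ) (θ ξ : Fin d → ℝ) : Fin d → ℝ := fun j => θ j + σ * ξ j

/-- The complement of the support of `θ`. -/
noncomputable def zeroSet (θ : Fin d → ℝ) : Finset (Fin d) := {j | θ j = 0}

lemma mem_zeroSet {j : Fin d} : j ∈ zeroSet θ ↔ θ j = 0 := Finset.mem_filter_univ _

lemma card_zeroSet_le : #(zeroSet θ) ≤ d := by
  simpa using (zeroSet θ).card_le_univ

lemma card_compl_zeroSet : #(zeroSet θ)ᶜ = hammingNorm θ := by
  rw [zeroSet, Finset.compl_filter, hammingNorm]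

lemma sub_sqrt_le_card_zeroSet (hθ : (hammingNorm θ : ℝ) ≤ √(d : ℝ)) :
    (d : ℝ) - √(d : ℝ) ≤ #(zeroSet θ) := by
  have card_add : (#(zeroSet θ) : ℝ) + hammingNorm θ = d := by
    rw [← card_compl_zeroSet]
    exact_mod_cast (zeroSet θ).card_add_card_compl.trans (Fintype.card_fin d)
  linarith

lemma observation_of_mem_zeroSet {j : Fin d} (hj : j ∈ zeroSet θ) (ξ : Fin d → ℝ) :
    observation σ θ ξ j = σ * ξ j := by
  rw [observation, mem_zeroSet.1 hj, zero_add]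

lemma observation_update_neg {j : Fin d} (hj : j ∈ zeroSet θ) (ξ : Fin d → ℝ) :
    observation σ θ (Function.update ξ j (-ξ j)) =
      Function.update (observation σ θ ξ) j (-observation σ θ ξ j) := by
  funext i
  obtain rfl | hij := eq_or_ne i j <;> simp [observation, mem_zeroSet.1, *]

@[fun_prop]
lemma measurable_observation : Measurable (observation σ θ) := by
  unfold observation
  fun_prop

lemma memLp_eval_noiseLaw (j : Fin d) : MemLp (fun ξ : Fin d → ℝ => ξ j) 2 (noiseLaw d) :=
  (memLp_id_gaussianReal 2).comp_measurePreserving (measurePreserving_eval _ j)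

lemma integrable_sq_eval_noiseLaw (j : Fin d) :
    Integrable (fun ξ : Fin d → ℝ => ξ j ^ 2) (noiseLaw d) :=
  (memLp_eval_noiseLaw j).integrable_sq

lemma integral_sq_eval_noiseLaw (j : Fin d) : ∫ ξ, ξ j ^ 2 ∂noiseLaw d = 1 := by
  rw [← integral_sq_gaussianReal]
  exact integral_comp_eval (μ := fun _ => gaussianReal 0 1) (f := fun u => u ^ 2) (by fun_prop)

lemma memLp_observation (j : Fin d) : MemLp (fun ξ => observation σ θ ξ j) 2 (noiseLaw d) :=
  (memLp_const (θ j)).add ((memLp_eval_noiseLaw j).const_mul σ)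

lemma sigmaHat_observation_sq_le (hθ : (hammingNorm θ : ℝ) ≤ √(d : ℝ)) (ξ : Fin d → ℝ) :
    sigmaHat (observation σ θ ξ) ^ 2 ≤ 9 / d * ∑ i ∈ zeroSet θ, σ ^ 2 * ξ i ^ 2 := by
  refine (sigmaHat_sq_le (sub_sqrt_le_card_zeroSet hθ) _).trans_eq ?_
  congr 1
  exact Finset.sum_congr rfl fun i hi => by rw [observation_of_mem_zeroSet hi, mul_pow]

lemma integrable_sigmaHat_sq (hθ : (hammingNorm θ : ℝ) ≤ √(d : ℝ)) :
    Integrable (fun ξ => sigmaHat (observation σ θ ξ) ^ 2) (noiseLaw d) :=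
  ((integrable_finsetSum (zeroSet θ) fun i _ =>
    (integrable_sq_eval_noiseLaw i).const_mul (σ ^ 2)).const_mul (9 / d)).mono'
    (Measurable.aestronglyMeasurable (by fun_prop))
    (.of_forall fun ξ => (Real.norm_of_nonneg (sq_nonneg _)).trans_le
      (sigmaHat_observation_sq_le hθ ξ))

lemma integral_sigmaHat_sq_le (hθ : (hammingNorm θ : ℝ) ≤ √(d : ℝ)) :
    ∫ ξ, sigmaHat (observation σ θ ξ) ^ 2 ∂noiseLaw d ≤ 9 * σ ^ 2 := by
  have sq_int : ∀ i ∈ zeroSet θ, Integrable (fun ξ => σ ^ 2 * ξ i ^ 2) (noiseLaw d) :=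
    fun i _ => (integrable_sq_eval_noiseLaw i).const_mul _
  calc ∫ ξ, sigmaHat (observation σ θ ξ) ^ 2 ∂noiseLaw d
      ≤ ∫ ξ, 9 / d * ∑ i ∈ zeroSet θ, σ ^ 2 * ξ i ^ 2 ∂noiseLaw d :=
        integral_mono (integrable_sigmaHat_sq hθ) ((integrable_finsetSum _ sq_int).const_mul _)
          (sigmaHat_observation_sq_le hθ)
    _ = 9 * σ ^ 2 * (#(zeroSet θ) / d) := by
        rw [integral_const_mul, integral_finsetSum _ sq_int]
        simp only [integral_const_mul, integral_sq_eval_noiseLaw, Finset.sum_const, nsmul_eq_mul]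
        ring
    _ ≤ 9 * σ ^ 2 :=
        mul_le_of_le_one_right (by positivity)
          (div_le_one_of_le₀ (by exact_mod_cast card_zeroSet_le) (Nat.cast_nonneg d))

end Observation

section HardThreshold

variable {d : ℕ} {σ t : ℝ} {θ : Fin d → ℝ}

/-- Coordinatewise hard thresholding of `y` at the data-driven level `t * sigmaHat y`. -/
noncomputable def hardThreshold (t : ℝ) (y : Fin d → ℝ) (j : Fin d) : ℝ :=
  if sigmaHat y * t < |y j| then y j else 0

lemma linEstimator_eq_sum_hardThreshold (s : ℕ) (y : Fin d → ℝ) :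
    linEstimator s y =
      ∑ j, hardThreshold √(2 * Real.log (1 + (d : ℝ) / (s : ℝ) ^ 2)) y j := rfl

lemma abs_hardThreshold_le (t : ℝ) (y : Fin d → ℝ) (j : Fin d) : |hardThreshold t y j| ≤ |y j| := by
  unfold hardThreshold
  split_ifs <;> simp

lemma abs_hardThreshold_sub_le (ht : 0 ≤ t) (y : Fin d → ℝ) (j : Fin d) (a : ℝ) :
    |hardThreshold t y j - a| ≤ |y j - a| + sigmaHat y * t := by
  have level_nonneg := mul_nonneg (sigmaHat_nonneg y) ht
  unfold hardThreshold
  split_ifs with h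
  · linarith
  · calc |0 - a| = |(y j - a) - y j| := by congr 1; ring
      _ ≤ |y j - a| + |y j| := abs_sub _ _
      _ ≤ |y j - a| + sigmaHat y * t := by gcongr; exact not_lt.1 h

lemma hardThreshold_update_neg_self (t : ℝ) (y : Fin d → ℝ) (j : Fin d) :
    hardThreshold t (Function.update y j (-y j)) j = -hardThreshold t y j := by
  simp only [hardThreshold, sigmaHat_update_neg, Function.update_self, abs_neg]
  split_ifs <;> simp

lemma hardThreshold_update_neg_of_ne (t : ℝ) (y : Fin d → ℝ) {i j : Fin d} (hij : i ≠ j) :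
    hardThreshold t (Function.update y j (-y j)) i = hardThreshold t y i := by
  simp only [hardThreshold, sigmaHat_update_neg, Function.update_of_ne hij]

@[fun_prop]
lemma measurable_hardThreshold (t : ℝ) (j : Fin d) :
    Measurable fun y : Fin d → ℝ => hardThreshold t y j :=
  .ite (measurableSet_lt (by fun_prop) (by fun_prop)) (by fun_prop) (by fun_prop)

lemma memLp_hardThreshold (j : Fin d) :
    MemLp (fun ξ => hardThreshold t (observation σ θ ξ) j) 2 (noiseLaw d) :=
  (memLp_observation j).mono (Measurable.aestronglyMeasurable (by fun_prop))
    (.of_forall fun _ => abs_hardThreshold_le ..)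

lemma integral_sq_hardThreshold_sub_le (ht : 0 ≤ t)
    (hθ : (hammingNorm θ : ℝ) ≤ √(d : ℝ)) (j : Fin d) :
    ∫ ξ, (hardThreshold t (observation σ θ ξ) j - θ j) ^ 2 ∂noiseLaw d ≤
      2 * σ ^ 2 + 18 * t ^ 2 * σ ^ 2 := by
  have noise_int := (integrable_sq_eval_noiseLaw j).const_mul (2 * σ ^ 2)
  have level_int := (integrable_sigmaHat_sq (σ := σ) hθ).const_mul (2 * t ^ 2)
  have sq_error_le (ξ : Fin d → ℝ) : (hardThreshold t (observation σ θ ξ) j - θ j) ^ 2 ≤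
      2 * σ ^ 2 * ξ j ^ 2 + 2 * t ^ 2 * sigmaHat (observation σ θ ξ) ^ 2 := by
    calc (hardThreshold t (observation σ θ ξ) j - θ j) ^ 2
        ≤ (|observation σ θ ξ j - θ j| + sigmaHat (observation σ θ ξ) * t) ^ 2 :=
          sq_le_sq' (neg_le_of_abs_le (abs_hardThreshold_sub_le ht ..))
            (le_of_abs_le (abs_hardThreshold_sub_le ht ..))
      _ ≤ 2 * (|observation σ θ ξ j - θ j| ^ 2 + (sigmaHat (observation σ θ ξ) * t) ^ 2) :=
          add_sq_le
      _ = 2 * σ ^ 2 * ξ j ^ 2 + 2 * t ^ 2 * sigmaHat (observation σ θ ξ) ^ 2 := by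
          rw [sq_abs, observation, add_sub_cancel_left]
          ring
  calc ∫ ξ, (hardThreshold t (observation σ θ ξ) j - θ j) ^ 2 ∂noiseLaw d
      ≤ ∫ ξ, 2 * σ ^ 2 * ξ j ^ 2 + 2 * t ^ 2 * sigmaHat (observation σ θ ξ) ^ 2 ∂noiseLaw d :=
        integral_mono ((memLp_hardThreshold j).sub (memLp_const _)).integrable_sq
          (noise_int.add level_int) sq_error_le
    _ = 2 * σ ^ 2 + 2 * t ^ 2 * ∫ ξ, sigmaHat (observation σ θ ξ) ^ 2 ∂noiseLaw d := by
        rw [integral_add noise_int level_int, integral_const_mul, integral_const_mul,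
          integral_sq_eval_noiseLaw, mul_one]
    _ ≤ 2 * σ ^ 2 + 2 * t ^ 2 * (9 * σ ^ 2) := by gcongr; exact integral_sigmaHat_sq_le hθ
    _ = 2 * σ ^ 2 + 18 * t ^ 2 * σ ^ 2 := by ring

lemma integral_hardThreshold_mul_eq_zero {i j : Fin d} (hij : i ≠ j) (hj : j ∈ zeroSet θ) :
    ∫ ξ, hardThreshold t (observation σ θ ξ) i * hardThreshold t (observation σ θ ξ) j
      ∂noiseLaw d = 0 := by
  refine integral_pi_eq_zero_of_odd ?_ j fun ξ => ?_
  · simpa using gaussianReal_map_neg (μ := 0) (v := 1)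
  · rw [observation_update_neg hj, hardThreshold_update_neg_self,
      hardThreshold_update_neg_of_ne _ _ hij, mul_neg]

lemma one_le_two_rpow_mul_prod_largeWeight (hσ : 0 < σ) {ξ : Fin d → ℝ}
    (h : sigmaHat (observation σ θ ξ) < σ) {T : Finset (Fin d)} (hT : T ⊆ zeroSet θ) :
    1 ≤ (2 : ℝ) ^ ((d : ℝ) / 4 + √(d : ℝ) + 1) * ∏ i ∈ T, largeWeight (ξ i) := by
  have card_le : (#{i ∈ T | 2 / 3 ≤ |ξ i|} : ℝ) ≤ d / 4 + √(d : ℝ) + 1 :=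
    card_le_of_sigmaHat_lt h fun i hi => by
      obtain ⟨hiT, hi⟩ := Finset.mem_filter.1 hi
      rw [observation_of_mem_zeroSet (hT hiT), abs_mul, abs_of_pos hσ, mul_comm]
      gcongr
  calc (1 : ℝ) = 2 ^ #{i ∈ T | 2 / 3 ≤ |ξ i|} * (1 / 2) ^ #{i ∈ T | 2 / 3 ≤ |ξ i|} := by
        rw [← mul_pow]; norm_num
    _ ≤ 2 ^ ((d : ℝ) / 4 + √(d : ℝ) + 1) * ∏ i ∈ T, largeWeight (ξ i) := by
        rw [prod_largeWeight, ← Real.rpow_natCast 2]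
        gcongr
        exact one_le_two

lemma sq_hardThreshold_le_of_le_sigmaHat (hσ : 0 < σ) (ht : 0 ≤ t) {j : Fin d}
    (hj : j ∈ zeroSet θ) {ξ : Fin d → ℝ} (h : σ ≤ sigmaHat (observation σ θ ξ)) :
    hardThreshold t (observation σ θ ξ) j ^ 2 ≤
      σ ^ 2 * {u | t < |u|}.indicator (fun u => u ^ 2) (ξ j) := by
  have tail_nonneg : 0 ≤ {u : ℝ | t < |u|}.indicator (fun u => u ^ 2) (ξ j) :=
    Set.indicator_nonneg (fun u _ => sq_nonneg u) _
  rw [hardThreshold, observation_of_mem_zeroSet hj, abs_mul, abs_of_pos hσ]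
  split_ifs with hlt
  · have : t < |ξ j| :=
      lt_of_mul_lt_mul_left ((mul_le_mul_of_nonneg_right h ht).trans_lt hlt) hσ.le
    simp [this, mul_pow]
  · rw [zero_pow two_ne_zero]
    positivity

lemma sq_hardThreshold_le (hσ : 0 < σ) (ht : 0 ≤ t) {j : Fin d} (hj : j ∈ zeroSet θ)
    (ξ : Fin d → ℝ) :
    hardThreshold t (observation σ θ ξ) j ^ 2 ≤
      σ ^ 2 * ({u | t < |u|}.indicator (fun u => u ^ 2) (ξ j) +
        2 ^ ((d : ℝ) / 4 + √(d : ℝ) + 1) *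
          (ξ j ^ 2 * ∏ i ∈ (zeroSet θ).erase j, largeWeight (ξ i))) := by
  have tail_nonneg : 0 ≤ {u : ℝ | t < |u|}.indicator (fun u => u ^ 2) (ξ j) :=
    Set.indicator_nonneg (fun u _ => sq_nonneg u) _
  have prod_nonneg : 0 ≤ ∏ i ∈ (zeroSet θ).erase j, largeWeight (ξ i) :=
    Finset.prod_nonneg fun i _ => largeWeight_nonneg _
  obtain h | h := lt_or_ge (sigmaHat (observation σ θ ξ)) σ
  · calc hardThreshold t (observation σ θ ξ) j ^ 2 ≤ (observation σ θ ξ j) ^ 2 :=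
          sq_le_sq.2 (abs_hardThreshold_le ..)
      _ = σ ^ 2 * (ξ j ^ 2 * 1) := by rw [observation_of_mem_zeroSet hj, mul_pow, mul_one]
      _ ≤ σ ^ 2 * (ξ j ^ 2 * (2 ^ ((d : ℝ) / 4 + √(d : ℝ) + 1) *
            ∏ i ∈ (zeroSet θ).erase j, largeWeight (ξ i))) := by
          gcongr
          exact one_le_two_rpow_mul_prod_largeWeight hσ h ((zeroSet θ).erase_subset j)
      _ ≤ _ := by
          gcongr
          rw [mul_left_comm]
          exact le_add_of_nonneg_left tail_nonneg
  · refine (sq_hardThreshold_le_of_le_sigmaHat hσ ht hj h).trans ?_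
    gcongr
    exact le_add_of_nonneg_right (by positivity)

lemma integral_sq_hardThreshold_le (hσ : 0 < σ) (ht0 : 0 < t) (ht : 4 / 3 ≤ t ^ 2)
    {j : Fin d} (hj : j ∈ zeroSet θ) :
    ∫ ξ, hardThreshold t (observation σ θ ξ) j ^ 2 ∂noiseLaw d ≤
      σ ^ 2 * (4 * t * Real.exp (-(t ^ 2 / 2)) + 2 ^ ((d : ℝ) / 4 + √(d : ℝ) + 1) *
        (2 ^ (-(3 / 8) : ℝ)) ^ (#(zeroSet θ) - 1)) := by
  have measurableSet_tail : MeasurableSet {u : ℝ | t < |u|} :=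
    measurableSet_lt (by fun_prop) (by fun_prop)
  let tail : ℝ → ℝ := {u | t < |u|}.indicator fun u => u ^ 2
  have tail_int : Integrable tail (gaussianReal 0 1) :=
    integrable_sq_gaussianReal.indicator measurableSet_tail
  have tail_eval_int : Integrable (fun ξ : Fin d → ℝ => tail (ξ j)) (noiseLaw d) :=
    integrable_comp_eval tail_int
  have integral_tail_le : ∫ ξ, tail (ξ j) ∂noiseLaw d ≤ 4 * t * Real.exp (-(t ^ 2 / 2)) := by
    rw [integral_comp_eval (μ := fun _ => gaussianReal 0 1) tail_int.aestronglyMeasurable,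
      integral_indicator measurableSet_tail]
    exact setIntegral_sq_gaussianReal_le ht0 ht
  obtain ⟨prod_int, integral_prod_eq⟩ :=
    integrable_and_integral_mul_prod_pi integrable_sq_gaussianReal integrable_largeWeight
      ((zeroSet θ).notMem_erase j)
  have prod_int' := prod_int.const_mul (2 ^ ((d : ℝ) / 4 + √(d : ℝ) + 1))
  calc ∫ ξ, hardThreshold t (observation σ θ ξ) j ^ 2 ∂noiseLaw d
      ≤ ∫ ξ, σ ^ 2 * (tail (ξ j) + 2 ^ ((d : ℝ) / 4 + √(d : ℝ) + 1) *
          (ξ j ^ 2 * ∏ i ∈ (zeroSet θ).erase j, largeWeight (ξ i))) ∂noiseLaw d :=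
        integral_mono (memLp_hardThreshold j).integrable_sq
          ((tail_eval_int.add prod_int').const_mul _) (sq_hardThreshold_le hσ ht0.le hj)
    _ = σ ^ 2 * (∫ ξ, tail (ξ j) ∂noiseLaw d + 2 ^ ((d : ℝ) / 4 + √(d : ℝ) + 1) *
          (∫ u, largeWeight u ∂gaussianReal 0 1) ^ (#(zeroSet θ) - 1)) := by
        rw [integral_const_mul, integral_add tail_eval_int prod_int', integral_const_mul,
          integral_prod_eq, integral_sq_gaussianReal, one_mul, Finset.card_erase_of_mem hj]
    _ ≤ _ := by
        gcongr
        · exact integral_nonneg largeWeight_nonneg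
        · exact integral_largeWeight_le

end HardThreshold

section Rate

lemma natCast_le_two_rpow_two_mul_sqrt (d : ℕ) : (d : ℝ) ≤ 2 ^ (2 * √(d : ℝ)) := by
  obtain rfl | hd := d.eq_zero_or_pos
  · simp
  have one_le : 1 ≤ √(d : ℝ) := Real.one_le_sqrt.2 (by exact_mod_cast hd)
  have bernoulli := one_add_mul_self_le_rpow_one_add (by norm_num : (-1 : ℝ) ≤ 1) one_le
  calc (d : ℝ) = √(d : ℝ) ^ 2 := (Real.sq_sqrt (Nat.cast_nonneg d)).symm
    _ ≤ (2 ^ √(d : ℝ)) ^ 2 := by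
        gcongr
        norm_num at bernoulli
        linarith
    _ = 2 ^ (2 * √(d : ℝ)) := by
        rw [← Real.rpow_mul_natCast zero_le_two, Nat.cast_ofNat, mul_comm]

lemma mul_two_rpow_mul_pow_le {d n : ℕ} (hn : (d : ℝ) - √(d : ℝ) ≤ n) :
    d * ((2 : ℝ) ^ ((d : ℝ) / 4 + √(d : ℝ) + 1) * (2 ^ (-(3 / 8) : ℝ)) ^ (n - 1)) ≤ 2 ^ 25 := by
  have sub_one_le : (n : ℝ) - 1 ≤ (n - 1 : ℕ) := by
    rw [sub_le_iff_le_add]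
    exact_mod_cast (by lia : n ≤ n - 1 + 1)
  have sq_sqrt : √(d : ℝ) ^ 2 = d := Real.sq_sqrt (Nat.cast_nonneg d)
  calc d * ((2 : ℝ) ^ ((d : ℝ) / 4 + √(d : ℝ) + 1) * (2 ^ (-(3 / 8) : ℝ)) ^ (n - 1))
      ≤ 2 ^ (2 * √(d : ℝ)) *
          (2 ^ ((d : ℝ) / 4 + √(d : ℝ) + 1) * (2 ^ (-(3 / 8) : ℝ)) ^ (n - 1)) := by
        gcongr
        exact natCast_le_two_rpow_two_mul_sqrt d
    _ = 2 ^ (2 * √(d : ℝ) + ((d : ℝ) / 4 + √(d : ℝ) + 1 + -(3 / 8) * (n - 1 : ℕ))) := by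
        rw [← Real.rpow_mul_natCast zero_le_two, ← Real.rpow_add two_pos, ← Real.rpow_add two_pos]
    _ ≤ 2 ^ (25 : ℝ) := by
        refine Real.rpow_le_rpow_of_exponent_le one_le_two ?_
        -- The exponent is at most `-x ^ 2 / 8 + 27 / 8 * x + 11 / 8` with `x = √d`.
        nlinarith [sq_nonneg (√(d : ℝ) - 27 / 2)]
    _ = 2 ^ 25 := by norm_num

variable {d s : ℕ}

lemma mul_exp_neg_log_one_add_div_sq_le (hs : 1 ≤ s) :
    d * Real.exp (-Real.log (1 + (d : ℝ) / (s : ℝ) ^ 2)) ≤ (s : ℝ) ^ 2 := by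
  have : (0 : ℝ) < s := by exact_mod_cast hs
  rw [Real.exp_neg, Real.exp_log (by positivity), ← div_eq_mul_inv, div_le_iff₀ (by positivity),
    mul_add, mul_div_cancel₀ _ (by positivity)]
  nlinarith

lemma two_thirds_le_log_one_add_div_sq (hs : 1 ≤ s) (hsd : (s : ℝ) ≤ √(d : ℝ)) :
    2 / 3 ≤ Real.log (1 + (d : ℝ) / (s : ℝ) ^ 2) := by
  have hs' : (0 : ℝ) < s := by exact_mod_cast hs
  have one_le : 1 ≤ (d : ℝ) / (s : ℝ) ^ 2 := by
    rw [one_le_div (by positivity)]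
    exact (Real.le_sqrt hs'.le (Nat.cast_nonneg d)).1 hsd
  calc (2 / 3 : ℝ) ≤ Real.log 2 := by linarith [Real.log_two_gt_d9]
    _ ≤ Real.log (1 + (d : ℝ) / (s : ℝ) ^ 2) := by gcongr; linarith

end Rate

section Risk

variable {d s : ℕ} {σ t : ℝ} {θ : Fin d → ℝ}

lemma sqRisk_le_ofReal {T : (Fin d → ℝ) → ℝ}
    (hT : Integrable (fun ξ => (T (observation σ θ ξ) - linFunctional θ) ^ 2) (noiseLaw d)) :
    sqRisk σ T θ ≤
      ENNReal.ofReal (∫ ξ, (T (observation σ θ ξ) - linFunctional θ) ^ 2 ∂noiseLaw d) := by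
  rw [ofReal_integral_eq_lintegral_ofReal hT (.of_forall fun _ => sq_nonneg _)]
  exact lintegral_map_le _ _

/-- The error of the thresholding estimator of `L(θ)` on the coordinates in `S`. -/
noncomputable def partialError (t σ : ℝ) (θ : Fin d → ℝ) (S : Finset (Fin d)) (ξ : Fin d → ℝ) : ℝ :=
  ∑ j ∈ S, (hardThreshold t (observation σ θ ξ) j - θ j)

lemma memLp_partialError (S : Finset (Fin d)) : MemLp (partialError t σ θ S) 2 (noiseLaw d) :=
  memLp_finsetSum S fun j _ => (memLp_hardThreshold j).sub (memLp_const (θ j))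

lemma integral_sq_partialError_compl_zeroSet_le (ht : 0 ≤ t)
    (hθ : (hammingNorm θ : ℝ) ≤ √(d : ℝ)) :
    ∫ ξ, partialError t σ θ (zeroSet θ)ᶜ ξ ^ 2 ∂noiseLaw d ≤
      (hammingNorm θ : ℝ) ^ 2 * (2 * σ ^ 2 + 18 * t ^ 2 * σ ^ 2) := by
  rw [← card_compl_zeroSet]
  exact integral_sq_sum_le_card_sq_mul
    (fun j _ => (memLp_hardThreshold j).sub (memLp_const (θ j)))
    fun j _ => integral_sq_hardThreshold_sub_le ht hθ j

lemma integral_sq_partialError_zeroSet_le (hσ : 0 < σ) (ht0 : 0 < t) (ht : 4 / 3 ≤ t ^ 2)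
    (hθ : (hammingNorm θ : ℝ) ≤ √(d : ℝ)) :
    ∫ ξ, partialError t σ θ (zeroSet θ) ξ ^ 2 ∂noiseLaw d ≤
      σ ^ 2 * (4 * t * (d * Real.exp (-(t ^ 2 / 2))) + 2 ^ 25) := by
  set rareTerm : ℝ := 2 ^ ((d : ℝ) / 4 + √(d : ℝ) + 1) *
    (2 ^ (-(3 / 8) : ℝ)) ^ (#(zeroSet θ) - 1)
  have error_eq (ξ : Fin d → ℝ) : partialError t σ θ (zeroSet θ) ξ =
      ∑ j ∈ zeroSet θ, hardThreshold t (observation σ θ ξ) j :=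
    Finset.sum_congr rfl fun j hj => by rw [mem_zeroSet.1 hj, sub_zero]
  calc ∫ ξ, partialError t σ θ (zeroSet θ) ξ ^ 2 ∂noiseLaw d
      = ∑ j ∈ zeroSet θ, ∫ ξ, hardThreshold t (observation σ θ ξ) j ^ 2 ∂noiseLaw d := by
        simp only [error_eq]
        exact integral_sq_sum_eq_of_orthogonal (fun j _ => memLp_hardThreshold j)
          fun i _ j hj hij => integral_hardThreshold_mul_eq_zero hij hj
    _ ≤ #(zeroSet θ) • (σ ^ 2 * (4 * t * Real.exp (-(t ^ 2 / 2)) + rareTerm)) :=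
        Finset.sum_le_card_nsmul _ _ _ fun j hj => integral_sq_hardThreshold_le hσ ht0 ht hj
    _ ≤ d * (σ ^ 2 * (4 * t * Real.exp (-(t ^ 2 / 2)) + rareTerm)) := by
        rw [nsmul_eq_mul]
        gcongr
        exact card_zeroSet_le
    _ = σ ^ 2 * (4 * t * (d * Real.exp (-(t ^ 2 / 2))) + d * rareTerm) := by ring
    _ ≤ σ ^ 2 * (4 * t * (d * Real.exp (-(t ^ 2 / 2))) + 2 ^ 25) := by
        gcongr
        exact mul_two_rpow_mul_pow_le (sub_sqrt_le_card_zeroSet hθ)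

lemma sqRisk_sum_hardThreshold_le (hσ : 0 < σ) (ht0 : 0 < t) (ht : 4 / 3 ≤ t ^ 2)
    (hθ : (hammingNorm θ : ℝ) ≤ √(d : ℝ)) :
    sqRisk σ (fun y => ∑ j, hardThreshold t y j) θ ≤
      ENNReal.ofReal (2 * (σ ^ 2 * (4 * t * (d * Real.exp (-(t ^ 2 / 2))) + 2 ^ 25)) +
        2 * ((hammingNorm θ : ℝ) ^ 2 * (2 * σ ^ 2 + 18 * t ^ 2 * σ ^ 2))) := by
  have error_eq (ξ : Fin d → ℝ) :
      ∑ j, hardThreshold t (observation σ θ ξ) j - linFunctional θ =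
        partialError t σ θ (zeroSet θ) ξ + partialError t σ θ (zeroSet θ)ᶜ ξ := by
    rw [partialError, partialError, Finset.sum_add_sum_compl, Finset.sum_sub_distrib,
      linFunctional]
  have off_memLp : MemLp (partialError t σ θ (zeroSet θ)) 2 (noiseLaw d) := memLp_partialError _
  have on_memLp : MemLp (partialError t σ θ (zeroSet θ)ᶜ) 2 (noiseLaw d) := memLp_partialError _
  refine (sqRisk_le_ofReal ?_).trans (ENNReal.ofReal_le_ofReal ?_)
  · simp only [error_eq]
    exact (off_memLp.add on_memLp).integrable_sq
  · simp only [error_eq]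
    refine (integral_add_sq_le off_memLp on_memLp).trans ?_
    gcongr
    · exact integral_sq_partialError_zeroSet_le hσ ht0 ht hθ
    · exact integral_sq_partialError_compl_zeroSet_le ht0.le hθ

lemma sqRisk_linEstimator_le (hs : 1 ≤ s) (hsd : (s : ℝ) ≤ √(d : ℝ)) (hσ : 0 < σ)
    (hθ : θ ∈ B0 d s) :
    sqRisk σ (linEstimator s) θ ≤ ENNReal.ofReal (2 ^ 27 * linRate σ s d) := by
  rw [funext (linEstimator_eq_sum_hardThreshold s)]
  set L := Real.log (1 + (d : ℝ) / (s : ℝ) ^ 2)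
  have L_ge : 2 / 3 ≤ L := two_thirds_le_log_one_add_div_sq hs hsd
  have one_le_sq : (1 : ℝ) ≤ (s : ℝ) ^ 2 := one_le_pow₀ (by exact_mod_cast hs)
  have norm_le : (hammingNorm θ : ℝ) ≤ s := by exact_mod_cast hθ
  have t_sq : √(2 * L) ^ 2 = 2 * L := Real.sq_sqrt (by positivity)
  have t_pos : 0 < √(2 * L) := Real.sqrt_pos.2 (by positivity)
  have t_le : √(2 * L) ≤ 2 * L := by nlinarith
  refine (sqRisk_sum_hardThreshold_le hσ t_pos (by linarith) (norm_le.trans hsd)).trans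
    (ENNReal.ofReal_le_ofReal ?_)
  rw [t_sq, mul_div_cancel_left₀ _ two_ne_zero]
  calc 2 * (σ ^ 2 * (4 * √(2 * L) * (d * Real.exp (-L)) + 2 ^ 25)) +
        2 * ((hammingNorm θ : ℝ) ^ 2 * (2 * σ ^ 2 + 18 * (2 * L) * σ ^ 2))
      ≤ 2 * (σ ^ 2 * (4 * (2 * L) * (s : ℝ) ^ 2 + 2 ^ 25 * (3 / 2 * L * (s : ℝ) ^ 2))) +
        2 * ((s : ℝ) ^ 2 * (2 * (3 / 2 * L) * σ ^ 2 + 18 * (2 * L) * σ ^ 2)) := by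
        gcongr
        · exact mul_exp_neg_log_one_add_div_sq_le hs
        · nlinarith
        · linarith
    _ = (94 + 3 * 2 ^ 25) * linRate σ s d := by rw [linRate]; ring
    _ ≤ 2 ^ 27 * linRate σ s d := by
        have : 0 ≤ linRate σ s d := by rw [linRate]; positivity
        gcongr
        norm_num

end Risk

end SparseMean

theorem theorem8 :
    ∃ C : ℝ, 0 < C ∧ ∀ d s : ℕ, 3 ≤ d → 1 ≤ s → (s : ℝ) ≤ √(d : ℝ) → ∀ σ : ℝ, 0 < σ →
      ⨆ θ ∈ SparseMean.B0 d s, SparseMean.sqRisk σ (SparseMean.linEstimator s) θ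
        ≤ ENNReal.ofReal (C * SparseMean.linRate σ s d) := by
  refine ⟨2 ^ 27, by positivity, fun d s _ hs hsd σ hσ => iSup₂_le fun θ hθ => ?_⟩
  exact SparseMean.sqRisk_linEstimator_le hs hsd hσ hθ
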